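/- **Theorem (super-linear dynamic-rank-query lower bound for matroid intersection and matroid union).** *Model.* For a matroid $\mathcal M=(U,\mathcal I)$ the dynamic rank oracle keeps a sequence of sets, starting with $S_0=\emptyset$ and $k=0$, and offers three operations: $\textsc{Insert}(v,i)$ creates $S_{k+1}:=S_i\cup\{v\}$ and increments $k$; $\textsc{Delete}(v,i)$ creates $S_{k+1}:=S_i\setminus\{v\}$ and increments $k$; $\textsc{Query}(i)$ returns the rank of $S_i$, i.e. the size of a largest independent subset of $S_i$. A deterministic algorithm for several matroids has access to one such oracle for each of them. It chooses each operation, and finally its output, depending only on the answers received so far; its internal computation is unrestricted. Its cost on an input is the total number of operations ($\textsc{Insert}$, $\textsc{Delete}$ and $\textsc{Query}$, over all oracles) that it performs. *Claim.* There are constants $c>0$ and $N$ such that for every finite set $U$ with $n:=|U|\ge N$ the following hold. 1. (Matroid intersection.) Let $A$ be a deterministic algorithm that, for any two matroids $(U,\mathcal I_1)$ and $(U,\mathcal I_2)$, outputs a set of maximum size in $\mathcal I_1\cap\mathcal I_2$. Then there are two matroids on $U$ on which $A$ performs at least $c\,n\log n$ operations. 2. (Matroid union.) Let $k\ge 2$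 and let $A$ be a deterministic algorithm that, for any $k$ matroids $(U,\mathcal I_1),\dots,(U,\mathcal I_k)$, outputs a set of maximum size among the sets $S_1\cup\dots\cup S_k$ with $S_i\in\mathcal I_i$ for every $i$. Then there are $k$ matroids on $U$ on which $A$ performs at least $c\,n\log n$ operations. The constants $c$ and $N$ do not depend on $k$. That is, any deterministic algorithm for matroid intersection or matroid union in the dynamic-rank-oracle model requires $\Omega(n\log n)$ operations in the worst case. -/

import Mathlib

/-- A deterministic algorithm with access to the dynamic rank oracles of `k` matroids on the ground
set `U`, as an adaptive decision tree. The oracle of the matroid `j` keeps its own sequence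
`S 0 = ∅, S 1, S 2, …` of sets, and the algorithm may ask it to
* `insert j v i next`: create the next set of oracle `j` as `S i ∪ {v}`;
* `delete j v i next`: create the next set of oracle `j` as `S i \ {v}`;
* `query j i next`: return the rank `r` of `S i` in the matroid `j`; the algorithm goes on
  with `next r`;

until it stops with an `output`. The next operation depends only on the answers seen so far.
Computation between the operations is unrestricted and free. -/
inductive DynRankAlg (k : ℕ) (U : Type*) : Type _
  | output (S : Finset U) : DynRankAlg k U
  | insert (j : Fin k) (v : U) (i : ℕ) (next : DynRankAlg k U) : DynRankAlg k U
  | delete (j : Fin k) (v : U) (i : ℕ) (next : DynRankAlg k U) : DynRankAlg k U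
  | query (j : Fin k) (i : ℕ) (next : ℕ → DynRankAlg k U) : DynRankAlg k U

namespace DynRankAlg

variable {k : ℕ} {U : Type*} [DecidableEq U]

/-- The memory of the oracles: for each matroid, the list of the sets created so far. -/
abbrev Memory (k : ℕ) (U : Type*) : Type _ := Fin k → List (Finset U)

/-- At the start, each oracle holds only the set `S 0 = ∅`. -/
def initMemory (k : ℕ) (U : Type*) : Memory k U := fun _ => [∅]

/-- The `i`-th set of oracle `j`. An index that is not in use refers to `S 0 = ∅`, which gives
an algorithm no additional power. -/
def getSet (σ : Memory k U) (j : Fin k) (i : ℕ) : Finset U := (σ j).getD i ∅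

/-- Append a new set to the sequence of oracle `j`. -/
def addSet (σ : Memory k U) (j : Fin k) (S : Finset U) : Memory k U :=
  Function.update σ j (σ j ++ [S])

/-- Run an algorithm on the matroids `M` from the memory `σ`. The result is the output together
with the total number of oracle operations (insertions, deletions and queries). -/
noncomputable def run (M : Fin k → Matroid U) : DynRankAlg k U → Memory k U → Finset U × ℕ
  | output S, _ => (S, 0)
  | insert j v i next, σ =>
      let res := run M next (addSet σ j (Insert.insert v (getSet σ j i)))
      (res.1, res.2 + 1)
  | delete j v i next, σ =>
      let res := run M next (addSet σ j ((getSet σ j i).erase v))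
      (res.1, res.2 + 1)
  | query j i next, σ =>
      let res := run M (next ((M j).eRk (getSet σ j i : Set U)).toNat) σ
      (res.1, res.2 + 1)

/-- The set that the algorithm outputs on the input `M`. -/
noncomputable def result (A : DynRankAlg k U) (M : Fin k → Matroid U) : Finset U :=
  (A.run M (initMemory k U)).1

/-- The number of oracle operations of the algorithm on the input `M`. -/
noncomputable def cost (A : DynRankAlg k U) (M : Fin k → Matroid U) : ℕ :=
  (A.run M (initMemory k U)).2

end DynRankAlg

/-- `S` is a common independent set of the matroids `M` of maximum size. -/
def IsMaxCommonIndep {k : ℕ} {U : Type*} (M : Fin k → Matroid U) (S : Finset U) : Prop :=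
  (∀ j, (M j).Indep (S : Set U)) ∧
    ∀ T : Finset U, (∀ j, (M j).Indep (T : Set U)) → T.card ≤ S.card

/-- `S` is of the form `I 0 ∪ ⋯ ∪ I (k - 1)`, with each `I j` independent in `M j`. -/
def IsUnionOfIndep {k : ℕ} {U : Type*} (M : Fin k → Matroid U) (S : Finset U) : Prop :=
  ∃ I : Fin k → Finset U, (∀ j, (M j).Indep (I j : Set U)) ∧ (S : Set U) = ⋃ j, (I j : Set U)

/-- `S` is a union of independent sets, one of each matroid, of maximum size. -/
def IsMaxUnionOfIndep {k : ℕ} {U : Type*} (M : Fin k → Matroid U) (S : Finset U) : Prop :=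
  IsUnionOfIndep M S ∧ ∀ T : Finset U, IsUnionOfIndep M T → T.card ≤ S.card

/-- The algorithm solves matroid intersection on the ground set `U`. -/
def DynRankAlg.SolvesIntersection {U : Type*} [DecidableEq U] (A : DynRankAlg 2 U) : Prop :=
  ∀ M : Fin 2 → Matroid U, (∀ j, (M j).E = Set.univ) → IsMaxCommonIndep M (A.result M)

/-- The algorithm solves matroid union for `k` matroids on the ground set `U`. -/
def DynRankAlg.SolvesUnion {k : ℕ} {U : Type*} [DecidableEq U] (A : DynRankAlg k U) : Prop :=
  ∀ M : Fin k → Matroid U, (∀ j, (M j).E = Set.univ) → IsMaxUnionOfIndep M (A.result M)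

/-! The bound is a log-rank argument. Let one party choose `x` and the other `y`, with each matroid
depending on only one of them. An update changes the rank of a stored set by at most one, so one
bit, known to one party, determines the new rank and splits a rectangle of inputs in two. On
rectangles where all stored ranks are constant a query reveals nothing. Hence `T` operations yield
at most `2 ^ T` rectangles with constant output, and a matrix determined by the output has rank at
most `2 ^ T` (`rank_le_two_pow_cost`).

The matrix used is indexed by the equivalence relations separating `x₀` from `x₁`, and records
whether `P ⊔ Q` still separates them. It factors as `Zᵀ D Z` with `Z` the zeta matrix and `D`
diagonal with nonzero entries, so it has full rank (`rank_joinMatrix`). On `2k + 2` points there are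
at least `k ^ k` such relations.

Each relation becomes a partition matroid whose capacities are class sizes. The largest common
independent set has `|X| + 1` elements if the join connects `x₀` to `x₁`, and `|X|` otherwise: a
flow along the join gives the extra element, a class of the join obstructs it. Dualising one matroid
carries this gap to matroid union. With `k` about `n / 4`, `T ≥ k log₂ k` gives the claim. -/

/-! ### Ranks of matrices cut into rectangles -/

/-- The part of a matrix supported on a combinatorial rectangle. -/
noncomputable def Matrix.rectangle {X Y : Type*} (F : Matrix X Y ℚ) (a : Set X) (b : Set Y) :
    Matrix X Y ℚ :=
  open Classical in Matrix.of fun x y => if x ∈ a ∧ y ∈ b then F x y else 0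

namespace Matrix

variable {X Y : Type*}

theorem rank_add_le_rank_add_rank [Fintype Y] (A B : Matrix X Y ℚ) :
    (A + B).rank ≤ A.rank + B.rank := by
  classical
  rw [Matrix.rank, Matrix.rank, Matrix.rank, Matrix.mulVecLin_add]
  exact (Submodule.finrank_mono (LinearMap.range_add_le _ _)).trans
    (Submodule.finrank_add_le_finrank_add_finrank _ _)

theorem rank_rectangle_split_left [Fintype Y] (F : Matrix X Y ℚ) (a : Set X) (b : Set Y)
    (p : X → Prop) :
    (F.rectangle a b).rank ≤
      (F.rectangle {x ∈ a | p x} b).rank + (F.rectangle {x ∈ a | ¬ p x} b).rank := by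
  refine le_trans (le_of_eq ?_) (rank_add_le_rank_add_rank _ _)
  congr 1
  ext x y
  simp only [rectangle, of_apply, add_apply, Set.mem_ofPred_eq]
  by_cases hx : x ∈ a <;> by_cases hy : y ∈ b <;> by_cases h : p x <;> simp_all

theorem rank_rectangle_split_right [Fintype Y] (F : Matrix X Y ℚ) (a : Set X) (b : Set Y)
    (p : Y → Prop) :
    (F.rectangle a b).rank ≤
      (F.rectangle a {y ∈ b | p y}).rank + (F.rectangle a {y ∈ b | ¬ p y}).rank := by
  refine le_trans (le_of_eq ?_) (rank_add_le_rank_add_rank _ _)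
  congr 1
  ext x y
  simp only [rectangle, of_apply, add_apply, Set.mem_ofPred_eq]
  by_cases hx : x ∈ a <;> by_cases hy : y ∈ b <;> by_cases h : p y <;> simp_all

theorem rank_rectangle_const [Fintype Y] (F : Matrix X Y ℚ) (a : Set X) (b : Set Y) (q : ℚ)
    (h : ∀ x ∈ a, ∀ y ∈ b, F x y = q) : (F.rectangle a b).rank ≤ 1 := by
  classical
  have : F.rectangle a b =
      vecMulVec (fun x => if x ∈ a then q else 0) (fun y => if y ∈ b then 1 else 0) := by
    ext x y
    by_cases hx : x ∈ a <;> by_cases hy : y ∈ b <;> simp [rectangle, vecMulVec, hx, hy, h]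
  rw [this]
  exact rank_vecMulVec_le _ _

theorem rectangle_eq_zero (F : Matrix X Y ℚ) (a : Set X) (b : Set Y)
    (h : ∀ x ∈ a, ∀ y ∈ b, False) : F.rectangle a b = 0 := by
  ext x y
  simp only [rectangle, of_apply, zero_apply, ite_eq_right_iff]
  exact fun hxy => (h x hxy.1 y hxy.2).elim

theorem rectangle_univ (F : Matrix X Y ℚ) : F.rectangle Set.univ Set.univ = F := by
  ext x y
  simp [rectangle]

end Matrix

/-! ### Dynamic-rank algorithms as two-party protocols -/

/-- The rank of `S'` is determined by the rank of `S` and one further bit. -/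
def RankStep {U : Type*} (S S' : Set U) : Prop :=
  ∀ N N' : Matroid U, N.eRk S = N'.eRk S → (N.eRk S' = N.eRk S ↔ N'.eRk S' = N'.eRk S) →
    N.eRk S' = N'.eRk S'

theorem rankStep_insert {U : Type*} (v : U) (S : Set U) : RankStep S (insert v S) := by
  have key (N : Matroid U) : N.eRk (insert v S) = N.eRk S ∨ N.eRk (insert v S) = N.eRk S + 1 := by
    rcases (N.eRk_mono (Set.subset_insert v S)).eq_or_lt with h | h
    · exact Or.inl h.symm
    · exact Or.inr ((N.eRk_insert_le_add_one v S).antisymm (Order.add_one_le_of_lt h))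
  intro N N' h hbit
  by_cases h1 : N.eRk (insert v S) = N.eRk S
  · rw [h1, hbit.1 h1, h]
  · rw [(key N).resolve_left h1, (key N').resolve_left (fun h2 => h1 (hbit.2 h2)), h]

theorem rankStep_diff {U : Type*} (v : U) (S : Set U) : RankStep S (S \ {v}) := by
  have key (N : Matroid U) : N.eRk (S \ {v}) = N.eRk S ∨ N.eRk (S \ {v}) + 1 = N.eRk S := by
    rcases (N.eRk_mono (Set.sdiff_subset (s := S) (t := {v}))).eq_or_lt with h | h
    · exact Or.inl h
    · refine Or.inr ((Order.add_one_le_of_lt h).antisymm ?_)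
      refine (N.eRk_mono ?_).trans (N.eRk_insert_le_add_one v (S \ {v}))
      intro u hu
      by_cases huv : u = v <;> simp [huv, hu]
  intro N N' h hbit
  by_cases h1 : N.eRk (S \ {v}) = N.eRk S
  · rw [h1, hbit.1 h1, h]
  · have e1 := (key N).resolve_left h1
    have e2 := (key N').resolve_left (fun h2 => h1 (hbit.2 h2))
    rw [← e1, ← e2] at h
    exact (ENat.add_left_injective_of_ne_top (by simp)) h

namespace DynRankAlg

variable {k : ℕ} {U : Type*}

theorem getSet_addSet (σ : Memory k U) (j j' : Fin k) (S : Finset U) (i : ℕ) :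
    (j' = j ∧ getSet (addSet σ j S) j' i = S) ∨
      ∃ i', getSet (addSet σ j S) j' i = getSet σ j' i' := by
  by_cases hj : j' = j
  · subst hj
    rcases lt_trichotomy i (σ j').length with h | h | h
    · right
      refine ⟨i, ?_⟩
      simp only [getSet, addSet, Function.update_self]
      exact List.getD_append _ _ _ _ h
    · left
      refine ⟨rfl, ?_⟩
      simp [getSet, addSet, h]
    -- Past the end of the extended list, both lookups give the default `∅`.
    · right
      refine ⟨i, ?_⟩
      simp only [getSet, addSet, Function.update_self]
      rw [List.getD_eq_default _ _ h.le, List.getD_eq_default]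
      simp
      omega
  · right
    refine ⟨i, ?_⟩
    simp [getSet, addSet, Function.update_of_ne hj]

variable {X Y : Type*}

/-- All inputs in the rectangle `a × b` give the same ranks to the sets in memory. -/
def ConstRanks (M : X → Y → Fin k → Matroid U) (σ : Memory k U) (a : Set X) (b : Set Y) : Prop :=
  ∀ j i, ∀ x ∈ a, ∀ y ∈ b, ∀ x' ∈ a, ∀ y' ∈ b,
    (M x y j).eRk (getSet σ j i : Set U) = (M x' y' j).eRk (getSet σ j i : Set U)

theorem ConstRanks.mono {M : X → Y → Fin k → Matroid U} {σ : Memory k U} {a a' : Set X}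
    {b b' : Set Y} (h : ConstRanks M σ a b) (ha : a' ⊆ a) (hb : b' ⊆ b) : ConstRanks M σ a' b' :=
  fun j i x hx y hy x' hx' y' hy' => h j i x (ha hx) y (hb hy) x' (ha hx') y' (hb hy')

theorem ConstRanks.addSet {M : X → Y → Fin k → Matroid U} {σ : Memory k U} {a : Set X}
    {b : Set Y} (h : ConstRanks M σ a b) (j : Fin k) (i : ℕ) (S : Finset U)
    (hS : RankStep (getSet σ j i : Set U) (S : Set U))
    (hbit : ∀ x ∈ a, ∀ y ∈ b, ∀ x' ∈ a, ∀ y' ∈ b,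
      ((M x y j).eRk (S : Set U) = (M x y j).eRk (getSet σ j i : Set U) ↔
        (M x' y' j).eRk (S : Set U) = (M x' y' j).eRk (getSet σ j i : Set U))) :
    ConstRanks M (addSet σ j S) a b := by
  intro j' i' x hx y hy x' hx' y' hy'
  rcases getSet_addSet σ j j' S i' with ⟨rfl, h1⟩ | ⟨i'', h1⟩
  · rw [h1]
    exact hS _ _ (h j' i x hx y hy x' hx' y' hy') (hbit x hx y hy x' hx' y' hy')
  · rw [h1]
    exact h j' i'' x hx y hy x' hx' y' hy'

/-- Each matroid depends on the input of one of two parties only. -/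
def IsSplit (M : X → Y → Fin k → Matroid U) : Prop :=
  ∀ j, (∃ N : X → Matroid U, ∀ x y, M x y j = N x) ∨ (∃ N : Y → Matroid U, ∀ x y, M x y j = N y)

variable [Fintype Y]

/-- The bit that fixes the new rank is a function of `x` alone or of `y` alone, so cutting by it
leaves two rectangles, and rank is subadditive. -/
theorem rank_rectangle_le_of_addSet {M : X → Y → Fin k → Matroid U} (hM : IsSplit M)
    (F : Matrix X Y ℚ) {σ : Memory k U} {a : Set X} {b : Set Y} (h : ConstRanks M σ a b)
    (j : Fin k) (i : ℕ) (S : Finset U) (hS : RankStep (getSet σ j i : Set U) (S : Set U)) (B : ℕ)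
    (hB : ∀ a' ⊆ a, ∀ b' ⊆ b, ConstRanks M (DynRankAlg.addSet σ j S) a' b' →
      (F.rectangle a' b').rank ≤ B) :
    (F.rectangle a b).rank ≤ B + B := by
  rcases hM j with ⟨N, hN⟩ | ⟨N, hN⟩
  · refine (F.rank_rectangle_split_left a b
      fun x => (N x).eRk (S : Set U) = (N x).eRk (getSet σ j i : Set U)).trans ?_
    refine Nat.add_le_add ?_ ?_
    · refine hB _ (Set.sep_subset _ _) _ subset_rfl
        ((h.mono (Set.sep_subset _ _) subset_rfl).addSet j i S hS ?_)
      intro x hx y _ x' hx' y' _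
      rw [hN, hN]
      exact iff_of_true hx.2 hx'.2
    · refine hB _ (Set.sep_subset _ _) _ subset_rfl
        ((h.mono (Set.sep_subset _ _) subset_rfl).addSet j i S hS ?_)
      intro x hx y _ x' hx' y' _
      rw [hN, hN]
      exact iff_of_false hx.2 hx'.2
  · refine (F.rank_rectangle_split_right a b
      fun y => (N y).eRk (S : Set U) = (N y).eRk (getSet σ j i : Set U)).trans ?_
    refine Nat.add_le_add ?_ ?_
    · refine hB _ subset_rfl _ (Set.sep_subset _ _)
        ((h.mono subset_rfl (Set.sep_subset _ _)).addSet j i S hS ?_)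
      intro x _ y hy x' _ y' hy'
      rw [hN, hN]
      exact iff_of_true hy.2 hy'.2
    · refine hB _ subset_rfl _ (Set.sep_subset _ _)
        ((h.mono subset_rfl (Set.sep_subset _ _)).addSet j i S hS ?_)
      intro x _ y hy x' _ y' hy'
      rw [hN, hN]
      exact iff_of_false hy.2 hy'.2

variable [DecidableEq U]

/-- If an algorithm makes at most `T` operations on the inputs of a rectangle and its output
determines the entries of a matrix there, then this part of the matrix has rank at most `2 ^ T`. -/
theorem rank_rectangle_le {M : X → Y → Fin k → Matroid U} (hM : IsSplit M)
    (F : Matrix X Y ℚ) (φ : Finset U → ℚ) (A : DynRankAlg k U) :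
    ∀ (σ : Memory k U) (T : ℕ) (a : Set X) (b : Set Y), ConstRanks M σ a b →
      (∀ x ∈ a, ∀ y ∈ b, (A.run (M x y) σ).2 ≤ T ∧ F x y = φ (A.run (M x y) σ).1) →
      (F.rectangle a b).rank ≤ 2 ^ T := by
  induction A with
  | output S =>
    intro σ T a b _ h
    refine (F.rank_rectangle_const a b (φ S) fun x hx y hy => ?_).trans Nat.one_le_two_pow
    simpa [run] using (h x hx y hy).2
  | insert j v i next ih =>
    intro σ T a b hc h
    -- Only an input in the rectangle forces `T` to be positive; an empty rectangle contributes the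
    -- zero matrix.
    by_cases he : ∃ x ∈ a, ∃ y ∈ b, True
    · obtain ⟨x, hx, y, hy, -⟩ := he
      obtain ⟨T, rfl⟩ : ∃ T', T = T' + 1 := by
        have := (h x hx y hy).1
        simp only [run] at this
        exact ⟨T - 1, by omega⟩
      rw [pow_succ, mul_two]
      refine rank_rectangle_le_of_addSet hM F hc j i (Insert.insert v (getSet σ j i))
        (by simpa using rankStep_insert v _) _ fun a' ha b' hb hc' => ih _ T a' b' hc' ?_
      intro x hx y hy
      simpa [run] using h x (ha hx) y (hb hy)
    · rw [F.rectangle_eq_zero a b fun x hx y hy => he ⟨x, hx, y, hy, trivial⟩]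
      simp
  | delete j v i next ih =>
    intro σ T a b hc h
    by_cases he : ∃ x ∈ a, ∃ y ∈ b, True
    · obtain ⟨x, hx, y, hy, -⟩ := he
      obtain ⟨T, rfl⟩ : ∃ T', T = T' + 1 := by
        have := (h x hx y hy).1
        simp only [run] at this
        exact ⟨T - 1, by omega⟩
      rw [pow_succ, mul_two]
      refine rank_rectangle_le_of_addSet hM F hc j i ((getSet σ j i).erase v)
        (by simpa using rankStep_diff v _) _ fun a' ha b' hb hc' => ih _ T a' b' hc' ?_
      intro x hx y hy
      simpa [run] using h x (ha hx) y (hb hy)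
    · rw [F.rectangle_eq_zero a b fun x hx y hy => he ⟨x, hx, y, hy, trivial⟩]
      simp
  | query j i next ih =>
    intro σ T a b hc h
    by_cases he : ∃ x ∈ a, ∃ y ∈ b, True
    · obtain ⟨x₀, hx₀, y₀, hy₀, -⟩ := he
      -- The answer is the same on the whole rectangle, so a single branch is followed and nothing
      -- is split.
      refine ih ((M x₀ y₀ j).eRk (getSet σ j i : Set U)).toNat σ T a b hc ?_
      intro x hx y hy
      have := h x hx y hy
      simp only [run] at this
      rw [hc j i x hx y hy x₀ hx₀ y₀ hy₀] at this
      exact ⟨by omega, this.2⟩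
    · rw [F.rectangle_eq_zero a b fun x hx y hy => he ⟨x, hx, y, hy, trivial⟩]
      simp

theorem rank_le_two_pow_cost {M : X → Y → Fin k → Matroid U} (hM : IsSplit M)
    (F : Matrix X Y ℚ) (φ : Finset U → ℚ) (A : DynRankAlg k U) (T : ℕ)
    (hT : ∀ x y, A.cost (M x y) ≤ T) (hF : ∀ x y, F x y = φ (A.result (M x y))) :
    F.rank ≤ 2 ^ T := by
  rw [← F.rectangle_univ]
  refine A.rank_rectangle_le hM F φ (initMemory k U) T _ _ ?_ fun x _ y _ => ⟨hT x y, hF x y⟩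
  intro j i x _ y _ x' _ y' _
  have : getSet (initMemory k U) j i = ∅ := by
    rcases i with _ | i <;> simp [getSet, initMemory]
  simp [this]

end DynRankAlg

/-! ### Counting colourings by their kernels -/

-- The value is `(-1)(-2)⋯(-n)`.
open Polynomial in
theorem eval_neg_one_descPochhammer_ne_zero (n : ℕ) : (descPochhammer ℚ n).eval (-1) ≠ 0 := by
  induction n with
  | zero => simp
  | succ n ih =>
    rw [descPochhammer_succ_eval]
    refine mul_ne_zero ih ?_
    have : (0 : ℚ) ≤ n := n.cast_nonneg
    intro h
    linarith

section Colourings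

variable {Z : Type*} (y₀ y₁ : Z) (p : ℕ)

/-- The maps to `Bool ⊕ Fin p` with two prescribed values correspond to the maps on the remaining
points. -/
noncomputable def prescribedEquiv (h : y₀ ≠ y₁) :
    {c : Z → Bool ⊕ Fin p // c y₀ = Sum.inl false ∧ c y₁ = Sum.inl true} ≃
      ({z : Z // z ≠ y₀ ∧ z ≠ y₁} → Bool ⊕ Fin p) where
  toFun c z := c.1 z.1
  invFun d := open Classical in
    ⟨fun z => if h0 : z = y₀ then Sum.inl false else if h1 : z = y₁ then Sum.inl true
      else d ⟨z, h0, h1⟩, by simp, by simp [h.symm]⟩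
  left_inv c := by
    ext z
    by_cases h0 : z = y₀
    · simp [h0, c.2.1]
    · by_cases h1 : z = y₁
      · simp [h1, h.symm, c.2.2]
      · simp [h0, h1]
  right_inv d := by
    ext z
    simp [z.2.1, z.2.2]

/-- The injective maps to `Bool ⊕ Fin p` with two prescribed values correspond to the injective maps
from the remaining points to `Fin p`. -/
noncomputable def prescribedInjEquiv (h : y₀ ≠ y₁) :
    {c : Z → Bool ⊕ Fin p // (c y₀ = Sum.inl false ∧ c y₁ = Sum.inl true) ∧ c.Injective} ≃
      ({z : Z // z ≠ y₀ ∧ z ≠ y₁} ↪ Fin p) where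
  toFun c :=
    have hr (z : {z : Z // z ≠ y₀ ∧ z ≠ y₁}) : (c.1 z.1).isRight := by
      rcases hz : c.1 z.1 with (_ | _) | i
      · exact absurd (c.2.2 (hz.trans c.2.1.1.symm)) z.2.1
      · exact absurd (c.2.2 (hz.trans c.2.1.2.symm)) z.2.2
      · rfl
    ⟨fun z => (c.1 z.1).getRight (hr z), fun z w hzw => Subtype.ext (c.2.2 (by
      rw [← Sum.inr_getRight _ (hr z), ← Sum.inr_getRight _ (hr w)]
      exact congrArg _ hzw))⟩
  invFun d := open Classical in
    ⟨fun z => if h0 : z = y₀ then Sum.inl false else if h1 : z = y₁ then Sum.inl true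
      else Sum.inr (d ⟨z, h0, h1⟩), ⟨by simp, by simp [h.symm]⟩, by
        intro z w
        simp only
        split_ifs with h1 h2 h3 h4 h5 h6 <;> simp_all⟩
  left_inv c := by
    ext z
    by_cases h0 : z = y₀
    · simp [h0, c.2.1.1]
    · by_cases h1 : z = y₁
      · simp [h1, h.symm, c.2.1.2]
      · simp only [h0, h1, dite_false]
        exact Sum.inr_getRight _ _
  right_inv d := by
    ext z
    simp [z.2.1, z.2.2]

theorem card_ne_and_ne [Finite Z] (h : y₀ ≠ y₁) :
    Nat.card {z : Z // z ≠ y₀ ∧ z ≠ y₁} = Nat.card Z - 2 := by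
  classical
  have := Fintype.ofFinite Z
  rw [Nat.card_eq_fintype_card, Nat.card_eq_fintype_card, Fintype.card_subtype]
  have : (Finset.univ.filter fun z : Z => z ≠ y₀ ∧ z ≠ y₁) = ({y₀, y₁} : Finset Z)ᶜ := by
    ext z
    simp
  rw [this, Finset.card_compl, Finset.card_pair h]

end Colourings

namespace Setoid

variable {X : Type*} {x₀ x₁ : X}

/-- A colouring that is constant on the classes of `S` is one of the quotient. -/
def colouringEquiv (S : Setoid X) (x₀ x₁ : X) (p : ℕ) :
    {c : X → Bool ⊕ Fin p // (c x₀ = Sum.inl false ∧ c x₁ = Sum.inl true) ∧ S ≤ ker c} ≃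
      {c : Quotient S → Bool ⊕ Fin p //
        c ⟦x₀⟧ = Sum.inl false ∧ c ⟦x₁⟧ = Sum.inl true} where
  toFun c := ⟨Quotient.lift c.1 fun _ _ h => c.2.2 h, c.2.1⟩
  invFun c := ⟨fun x => c.1 ⟦x⟧, c.2, fun _ _ h => congrArg c.1 (Quotient.sound h)⟩
  left_inv _ := rfl
  right_inv c := by
    ext z
    induction z using Quotient.ind
    rfl

/-- A colouring with kernel `S` is an injective one of the quotient. -/
def injColouringEquiv (S : Setoid X) (x₀ x₁ : X) (p : ℕ) :
    {c : X → Bool ⊕ Fin p // (c x₀ = Sum.inl false ∧ c x₁ = Sum.inl true) ∧ ker c = S} ≃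
      {c : Quotient S → Bool ⊕ Fin p //
        (c ⟦x₀⟧ = Sum.inl false ∧ c ⟦x₁⟧ = Sum.inl true) ∧ c.Injective} where
  toFun c := ⟨Quotient.lift c.1 fun x y h => by
      have h' : ker c.1 x y := by rw [c.2.2]; exact h
      exact h', c.2.1, by
    intro z w
    induction z using Quotient.ind
    induction w using Quotient.ind
    intro h
    refine Quotient.sound ?_
    have h' : ker c.1 _ _ := h
    rw [c.2.2] at h'
    exact h'⟩
  invFun c := ⟨fun x => c.1 ⟦x⟧, c.2.1, by
    ext x y
    exact ⟨fun h => Quotient.exact (c.2.2 h), fun h => congrArg c.1 (Quotient.sound h)⟩⟩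
  left_inv _ := rfl
  right_inv c := by
    ext z
    induction z using Quotient.ind
    rfl

variable [Finite X]

theorem card_colouring (S : Setoid X) (h : ¬ S x₀ x₁) (p : ℕ) :
    Nat.card {c : X → Bool ⊕ Fin p //
      (c x₀ = Sum.inl false ∧ c x₁ = Sum.inl true) ∧ S ≤ ker c} =
      (p + 2) ^ (Nat.card (Quotient S) - 2) := by
  have h' : (⟦x₀⟧ : Quotient S) ≠ ⟦x₁⟧ := fun e => h (Quotient.exact e)
  rw [Nat.card_congr ((colouringEquiv S x₀ x₁ p).trans (prescribedEquiv _ _ p h')), Nat.card_fun,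
    card_ne_and_ne _ _ h']
  simp [add_comm]

/-- Injectivity bars the other classes from the two prescribed colours, leaving `p` colours for
them. -/
theorem card_injColouring (S : Setoid X) (h : ¬ S x₀ x₁) (p : ℕ) :
    Nat.card {c : X → Bool ⊕ Fin p //
      (c x₀ = Sum.inl false ∧ c x₁ = Sum.inl true) ∧ ker c = S} =
      p.descFactorial (Nat.card (Quotient S) - 2) := by
  classical
  have h' : (⟦x₀⟧ : Quotient S) ≠ ⟦x₁⟧ := fun e => h (Quotient.exact e)
  have := Fintype.ofFinite (Quotient S)
  rw [Nat.card_congr ((injColouringEquiv S x₀ x₁ p).trans (prescribedInjEquiv _ _ p h')),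
    ← card_ne_and_ne _ _ h', Nat.card_eq_fintype_card, Fintype.card_embedding_eq,
    Nat.card_eq_fintype_card, Fintype.card_fin]

instance : Finite (Setoid X) :=
  Finite.of_injective (fun S : Setoid X => (fun x y => S x y : X → X → Prop)) fun S T h => by
    ext x y
    exact iff_of_eq (congrFun (congrFun h x) y)

variable (x₀ x₁) in
/-- The equivalence relations that separate two given points. -/
abbrev Separating : Type _ := {S : Setoid X // ¬ S x₀ x₁}

noncomputable instance : Fintype (Separating x₀ x₁) := Fintype.ofFinite _

-- Sort the colourings constant on the classes of `S` by their kernel, which separates the two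
-- points because their colours differ.
open Classical in
theorem sum_descFactorial (S : Separating x₀ x₁) (p : ℕ) :
    ∑ R : Separating x₀ x₁ with S ≤ R, p.descFactorial (Nat.card (Quotient R.1) - 2) =
      (p + 2) ^ (Nat.card (Quotient S.1) - 2) := by
  have := Fintype.ofFinite X
  rw [← card_colouring S.1 S.2 p]
  simp_rw [← fun R : Separating x₀ x₁ => card_injColouring R.1 R.2 p]
  simp_rw [Nat.card_eq_fintype_card, Fintype.card_subtype]
  have hker (c : X → Bool ⊕ Fin p) (hc : c x₀ = Sum.inl false ∧ c x₁ = Sum.inl true) :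
      ¬ ker c x₀ x₁ := by
    rw [ker_def, hc.1, hc.2]
    simp
  rw [← Finset.card_biUnion]
  · congr 1
    ext c
    simp only [Finset.mem_biUnion, Finset.mem_filter, Finset.mem_univ, true_and]
    constructor
    · rintro ⟨R, hR, hc, hk⟩
      exact ⟨hc, hk ▸ hR⟩
    · rintro ⟨hc, hS⟩
      exact ⟨⟨ker c, hker c hc⟩, hS, hc, rfl⟩
  · intro R _ R' _ hne
    rw [Function.onFun, Finset.disjoint_left]
    intro c hc hc'
    simp only [Finset.mem_filter, Finset.mem_univ, true_and] at hc hc'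
    exact hne (Subtype.ext (hc.2.symm.trans hc'.2))

/-- The weights that invert the zeta matrix. -/
noncomputable def weight (R : Setoid X) : ℚ :=
  (descPochhammer ℚ (Nat.card (Quotient R) - 2)).eval (-1)

-- The colouring count holds for every natural `p`, hence as a polynomial identity; at `p = -1` the
-- base `p + 2` becomes `1`.
open Classical Polynomial in
theorem sum_weight (S : Separating x₀ x₁) :
    ∑ R : Separating x₀ x₁ with S ≤ R, weight R.1 = 1 := by
  have key : ∑ R : Separating x₀ x₁ with S ≤ R,
      descPochhammer ℚ (Nat.card (Quotient R.1) - 2) =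
      (Polynomial.X + C 2) ^ (Nat.card (Quotient S.1) - 2) := by
    refine eq_of_infinite_eval_eq _ _ (Set.Infinite.mono ?_
      (Set.infinite_range_of_injective (Nat.cast_injective (R := ℚ))))
    rintro _ ⟨p, rfl⟩
    simp only [Set.mem_ofPred_eq, eval_finsetSum, descPochhammer_eval_eq_descFactorial, eval_pow,
      eval_add, eval_X, eval_C]
    exact_mod_cast sum_descFactorial S p
  have := congrArg (eval (-1)) key
  rw [eval_finsetSum] at this
  simp only [eval_pow, eval_add, eval_X, eval_C] at this
  norm_num at this
  exact this

/-! ### The join matrix has full rank -/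

open Classical in
variable (x₀ x₁) in
/-- The matrix that tells whether two points are separated by the join of two equivalence
relations. -/
noncomputable def joinMatrix : Matrix (Separating x₀ x₁) (Separating x₀ x₁) ℚ :=
  Matrix.of fun P Q => if (P.1 ⊔ Q.1) x₀ x₁ then 0 else 1

-- This is the factorisation `Zᵀ D Z`: the common upper bounds of `P` and `Q` are those of `P ⊔ Q`,
-- and none is separating when the join is not.
open Classical in
theorem joinMatrix_apply_eq_sum (P Q : Separating x₀ x₁) :
    joinMatrix x₀ x₁ P Q = ∑ R : Separating x₀ x₁, if P ≤ R ∧ Q ≤ R then weight R.1 else 0 := by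
  rw [← Finset.sum_filter, joinMatrix, Matrix.of_apply]
  split_ifs with h
  · rw [Finset.filter_false_of_mem, Finset.sum_empty]
    rintro R - ⟨hP, hQ⟩
    exact R.2 ((sup_le hP hQ : P.1 ⊔ Q.1 ≤ R.1) h)
  · rw [← sum_weight (⟨P.1 ⊔ Q.1, h⟩ : Separating x₀ x₁)]
    refine Finset.sum_congr (Finset.filter_congr fun R _ => ?_) fun _ _ => rfl
    exact sup_le_iff (a := P.1) (b := Q.1) (c := R.1)

-- The zeta matrix is unitriangular, hence injective.
open Classical in
theorem eq_zero_of_sum_le {α : Type*} [PartialOrder α] [Fintype α] (v : α → ℚ)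
    (h : ∀ R, ∑ Q with Q ≤ R, v Q = 0) : v = 0 := by
  funext R
  induction R using WellFoundedLT.induction with
  | ind R ih =>
    have hR := h R
    rwa [Finset.sum_eq_single_of_mem R (by simp)] at hR
    intro Q hQ hne
    exact ih Q (lt_of_le_of_ne (Finset.mem_filter.1 hQ).2 hne)

open Classical in
theorem eq_zero_of_sum_ge {α : Type*} [PartialOrder α] [Fintype α] (v : α → ℚ)
    (h : ∀ R, ∑ Q with R ≤ Q, v Q = 0) : v = 0 := by
  funext R
  induction R using WellFoundedGT.induction with
  | ind R ih =>
    have hR := h R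
    rwa [Finset.sum_eq_single_of_mem R (by simp)] at hR
    intro Q hQ hne
    exact ih Q (lt_of_le_of_ne (Finset.mem_filter.1 hQ).2 hne.symm)

theorem rank_joinMatrix : (joinMatrix x₀ x₁).rank = Nat.card (Separating x₀ x₁) := by
  classical
  rw [Nat.card_eq_fintype_card]
  refine Matrix.rank_of_isUnit _ (Matrix.mulVec_injective_iff_isUnit.1 ?_)
  rw [← Matrix.coe_mulVecLin, ← LinearMap.ker_eq_bot, LinearMap.ker_eq_bot']
  intro v hv
  -- Cancel the outer zeta matrix first; the nonzero weights and the inner one follow.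
  have hw : (fun R : Separating x₀ x₁ => weight R.1 * ∑ Q with Q ≤ R, v Q) = 0 := by
    refine eq_zero_of_sum_ge _ fun P => ?_
    have hP := congrFun hv (P)
    simp only [Matrix.mulVecLin_apply, Matrix.mulVec, dotProduct, joinMatrix_apply_eq_sum,
      Pi.zero_apply, Finset.sum_mul] at hP
    rw [Finset.sum_comm] at hP
    rw [← hP, Finset.sum_filter]
    refine Finset.sum_congr rfl fun R _ => ?_
    by_cases hR : P ≤ R
    · rw [if_pos hR, Finset.mul_sum, Finset.sum_filter]
      refine Finset.sum_congr rfl fun Q _ => ?_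
      by_cases hQ : Q ≤ R
      · rw [if_pos hQ, if_pos ⟨hR, hQ⟩]
      · rw [if_neg hQ, if_neg fun h => hQ h.2, zero_mul]
    · rw [if_neg hR]
      refine (Finset.sum_eq_zero fun Q _ => ?_).symm
      rw [if_neg fun h => hR h.1, zero_mul]
  refine eq_zero_of_sum_le v fun R => ?_
  exact (mul_eq_zero.1 (congrFun hw R)).resolve_left
    (eval_neg_one_descPochhammer_ne_zero _)

end Setoid

/-! ### Many separating relations -/

/-- The equivalence relation in which the `i`-th point of the first kind is glued to the
`f i`-th point of the second kind. -/
def gluing {k : ℕ} (f : Fin k → Fin k) :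
    Setoid.Separating (X := (Fin k ⊕ Fin k) ⊕ Bool) (Sum.inr false) (Sum.inr true) :=
  ⟨Setoid.ker (Sum.map (Sum.elim f id) id), by simp [Setoid.ker_def]⟩

/-- Points of the second kind stay pairwise inequivalent, so the one glued to the `i`-th point
reveals `f i`. -/
theorem gluing_injective {k : ℕ} : Function.Injective (gluing (k := k)) := by
  intro f f' h
  funext i
  have h1 : (gluing f).1 (Sum.inl (Sum.inl i)) (Sum.inl (Sum.inr (f i))) := rfl
  rw [h] at h1
  have h2 : (Sum.inl (f' i) : Fin k ⊕ Bool) = Sum.inl (f i) := h1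
  exact (Sum.inl_injective h2).symm

theorem pow_le_card_separating (k : ℕ) :
    k ^ k ≤ Nat.card (Setoid.Separating (X := (Fin k ⊕ Fin k) ⊕ Bool)
      (Sum.inr false) (Sum.inr true)) := by
  refine le_trans (le_of_eq ?_) (Nat.card_le_card_of_injective _ gluing_injective)
  simp

/-! ### Partition matroids from equivalence relations -/

open Classical in
/-- The partition matroid with classes given by the fibres of `f` and capacities `cap`. -/
noncomputable def partitionMatroid {U C : Type*} (f : U → C) (cap : C → ℕ) : Matroid U :=
  (IndepMatroid.ofFinset Set.univ (fun I : Finset U => ∀ c, (I.filter (f · = c)).card ≤ cap c)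
    (by simp)
    (fun I J hJ hIJ c => (Finset.card_le_card (Finset.filter_subset_filter _ hIJ)).trans (hJ c))
    (fun I J hI hJ hlt => by
      obtain ⟨c, hc⟩ : ∃ c, (I.filter (f · = c)).card < (J.filter (f · = c)).card := by
        by_contra! h
        refine hlt.not_ge ?_
        rw [Finset.card_eq_sum_card_fiberwise (f := f) (t := (I ∪ J).image f) (s := I),
          Finset.card_eq_sum_card_fiberwise (f := f) (t := (I ∪ J).image f) (s := J)]
        · exact Finset.sum_le_sum fun c _ => h c
        · intro u hu
          exact Finset.mem_coe.2 (Finset.mem_image_of_mem f (Finset.mem_union_right I hu))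
        · intro u hu
          exact Finset.mem_coe.2 (Finset.mem_image_of_mem f (Finset.mem_union_left J hu))
      obtain ⟨e, heJ, heI⟩ := Finset.exists_mem_notMem_of_card_lt_card hc
      rw [Finset.mem_filter] at heJ heI
      refine ⟨e, heJ.1, fun h => heI ⟨h, heJ.2⟩, fun c' => ?_⟩
      rw [Finset.filter_insert]
      split_ifs with h
      · obtain rfl : c = c' := heJ.2.symm.trans h
        exact (Finset.card_insert_le _ _).trans (hc.trans_le (hJ c))
      · exact hI c')
    (fun _ _ => Set.subset_univ _)).matroid

open Classical in
theorem partitionMatroid_indep {U C : Type*} (f : U → C) (cap : C → ℕ) (I : Finset U) :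
    (partitionMatroid f cap).Indep (I : Set U) ↔ ∀ c, (I.filter (f · = c)).card ≤ cap c := by
  simp [partitionMatroid]

section BlockMatroid

variable {X U : Type*}

open Classical in
/-- The partition matroid in which the elements labelled by the members of a class of `S` have the
size of this class as joint capacity, and those without a label have capacity one. -/
noncomputable def blockMatroid [Fintype X] (S : Setoid X) (f : U → Option X) : Matroid U :=
  partitionMatroid (fun u => (f u).map (Quotient.mk S))
    fun c => c.elim 1 fun q => (Finset.univ.filter fun x => Quotient.mk S x = q).card

@[simp]
theorem blockMatroid_ground [Fintype X] (S : Setoid X) (f : U → Option X) :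
    (blockMatroid S f).E = Set.univ := rfl

open Classical in
theorem blockMatroid_indep [Fintype X] (S : Setoid X) (f : U → Option X) (I : Finset U) :
    (blockMatroid S f).Indep (I : Set U) ↔ (I.filter (f · = none)).card ≤ 1 ∧
      ∀ q, (I.filter fun u => (f u).map (Quotient.mk S) = some q).card ≤
        (Finset.univ.filter fun x => Quotient.mk S x = q).card := by
  rw [blockMatroid, partitionMatroid_indep, Option.forall]
  simp

-- A set closed under `S` is a union of classes, and their capacities add up to its size.
open Classical in
theorem card_le_of_saturated [Fintype X] {S : Setoid X} {f : U → Option X} {I : Finset U}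
    (hI : (blockMatroid S f).Indep (I : Set U)) (D : Finset X)
    (hD : ∀ x y, S x y → x ∈ D → y ∈ D) :
    (I.filter fun u => ∃ x ∈ D, f u = some x).card ≤ D.card := by
  rw [blockMatroid_indep] at hI
  rw [Finset.card_eq_sum_card_fiberwise (f := fun u => (f u).map (Quotient.mk S))
      (t := D.image fun x => some (Quotient.mk S x)),
    Finset.card_eq_sum_card_fiberwise (f := fun x => some (Quotient.mk S x))
      (t := D.image fun x => some (Quotient.mk S x)) (s := D)]
  · refine Finset.sum_le_sum fun c hc => ?_
    obtain ⟨x, hx, rfl⟩ := Finset.mem_image.1 hc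
    refine (Finset.card_le_card (Finset.filter_subset_filter _
      (Finset.filter_subset _ _))).trans ((hI.2 (Quotient.mk S x)).trans ?_)
    refine Finset.card_le_card fun y hy => ?_
    rw [Finset.mem_filter] at hy ⊢
    exact ⟨hD x y (S.symm (Quotient.exact hy.2)) hx, congrArg some hy.2⟩
  · intro x hx
    exact Finset.mem_coe.2 (Finset.mem_image_of_mem _ hx)
  · intro u hu
    obtain ⟨-, x, hx, hu⟩ := Finset.mem_filter.1 hu
    refine Finset.mem_coe.2 (Finset.mem_image.2 ⟨x, hx, ?_⟩)
    simp [hu]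

theorem card_le_add_one [Fintype X] {S : Setoid X} {f : U → Option X} {I : Finset U}
    (hI : (blockMatroid S f).Indep (I : Set U)) : I.card ≤ Fintype.card X + 1 := by
  classical
  have h1 := card_le_of_saturated hI Finset.univ (by simp)
  rw [blockMatroid_indep] at hI
  rw [← Finset.card_filter_add_card_filter_not (s := I) (fun u => ∃ x ∈ Finset.univ, f u = some x)]
  refine Nat.add_le_add (by convert h1; exact Finset.card_univ.symm)
    (le_trans (Finset.card_le_card fun u hu => ?_) hI.1)
  simp only [Finset.mem_filter, Finset.mem_univ, true_and, not_exists] at hu ⊢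
  exact ⟨hu.1, Option.eq_none_iff_forall_ne_some.2 hu.2⟩

/-! ### Unit flows along a join -/

section Flow

open Classical in
/-- The sum of `d` over a class. -/
noncomputable def classSum [Fintype X] (S : Setoid X) (q : Quotient S) : (X → ℤ) →+ ℤ where
  toFun d := ∑ x with Quotient.mk S x = q, d x
  map_zero' := by simp
  map_add' _ _ := by simp [Finset.sum_add_distrib]

open Classical in
theorem classSum_single [Fintype X] (S : Setoid X) (q : Quotient S) (z : X) :
    classSum S q (Pi.single z 1) = if Quotient.mk S z = q then 1 else 0 := by
  simp [classSum, Pi.single_apply, Finset.sum_ite_eq']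

/-- The functions with values in `{-1, 0, 1}` that vanish outside `A`. -/
def SmallOn (A : Finset X) (d : X → ℤ) : Prop := (∀ x, |d x| ≤ 1) ∧ ∀ x ∉ A, d x = 0

open Classical in
/-- `d` is a unit flow from the class of `x` for `S` to the class of `y` for `T`. -/
def IsFlow [Fintype X] (S T : Setoid X) (x y : X) (d : X → ℤ) : Prop :=
  (∀ q, classSum S q d = if Quotient.mk S x = q then 1 else 0) ∧
    ∀ q, classSum T q d = if Quotient.mk T y = q then 1 else 0

open Classical in
/-- `d` is a unit flow from the class of `x` to the class of `y`, both for `S`. -/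
def IsReturnFlow [Fintype X] (S T : Setoid X) (x y : X) (d : X → ℤ) : Prop :=
  (∀ q, classSum S q d =
    (if Quotient.mk S x = q then 1 else 0) - if Quotient.mk S y = q then 1 else 0) ∧
    ∀ q, classSum T q d = 0

theorem SmallOn.mono {A B : Finset X} {d : X → ℤ} (h : SmallOn A d) (hAB : A ⊆ B) : SmallOn B d :=
  ⟨h.1, fun x hx => h.2 x fun hA => hx (hAB hA)⟩

open Classical in
theorem SmallOn.insert {A : Finset X} {d : X → ℤ} (h : SmallOn A d) {w : X} (hw : w ∉ A) {e : ℤ}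
    (he : |e| ≤ 1) : SmallOn (insert w A) (d + e • Pi.single w 1) := by
  constructor
  · intro x
    by_cases hx : x = w
    · subst hx
      simpa [h.2 x hw] using he
    · simpa [hx] using h.1 x
  · intro x hx
    rw [Finset.mem_insert, not_or] at hx
    simp [hx.1, h.2 x hx.2]

/-- Both kinds of flow exist to all points of `A`, within `A`. -/
def FlowsWithin [Fintype X] (S T : Setoid X) (x : X) (A : Finset X) : Prop :=
  ∀ z ∈ A, (∃ d, SmallOn A d ∧ IsFlow S T x z d) ∧ ∃ d, SmallOn A d ∧ IsReturnFlow S T x z d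

open Classical in
theorem flowsWithin_singleton [Fintype X] (S T : Setoid X) (x : X) : FlowsWithin S T x {x} := by
  intro z hz
  obtain rfl := Finset.mem_singleton.1 hz
  have h0 : SmallOn (∅ : Finset X) (0 : X → ℤ) := ⟨by simp, by simp⟩
  refine ⟨⟨0 + (1 : ℤ) • Pi.single z 1, h0.insert (by simp) (by simp), ?_, ?_⟩,
    0, h0.mono (by simp), ?_, ?_⟩
  · simp [classSum_single]
  · simp [classSum_single]
  · simp
  · simp

-- Across an `S`-step the return flow to `a` serves `w`, and adding one at `w` makes it a flow.
-- Across a `T`-step the flow serves `w`, and subtracting one at `w` makes it a return flow. Values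
-- stay in `{-1, 0, 1}` because `d` vanishes at the new point.
open Classical in
theorem FlowsWithin.insert [Fintype X] {S T : Setoid X} {x a w : X} {A : Finset X}
    (h : FlowsWithin S T x A) (ha : a ∈ A) (hw : w ∉ A) (haw : S a w ∨ T a w) :
    FlowsWithin S T x (insert w A) := by
  have hA : A ⊆ Insert.insert w A := Finset.subset_insert _ _
  intro z hz
  rcases Finset.mem_insert.1 hz with rfl | hz
  · obtain ⟨⟨d, hd, hS, hT⟩, d', hd', hS', hT'⟩ := h a ha
    rcases haw with haz | haz
    · rw [Quotient.sound haz] at hS'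
      refine ⟨⟨d' + (1 : ℤ) • Pi.single z 1, hd'.insert hw (by simp), fun q => ?_, fun q => ?_⟩,
        d', hd'.mono hA, hS', hT'⟩
      · rw [map_add, hS', one_smul, classSum_single, sub_add_cancel]
      · rw [map_add, hT', one_smul, classSum_single, zero_add]
    · rw [Quotient.sound haz] at hT
      refine ⟨⟨d, hd.mono hA, hS, hT⟩, d + (-1 : ℤ) • Pi.single z 1, hd.insert hw (by simp),
        fun q => ?_, fun q => ?_⟩
      · rw [map_add, hS, map_zsmul, classSum_single, neg_one_smul, sub_eq_add_neg]
      · rw [map_add, hT, map_zsmul, classSum_single, neg_one_smul, add_neg_cancel]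
  · obtain ⟨⟨d, hd, h1⟩, d', hd', h2⟩ := h z hz
    exact ⟨⟨d, hd.mono hA, h1⟩, d', hd'.mono hA, h2⟩

/-- A maximal set reached by such flows is closed under both relations, hence under their join. -/
theorem exists_isFlow [Fintype X] {S T : Setoid X} {x y : X} (h : (S ⊔ T) x y) :
    ∃ d : X → ℤ, (∀ z, |d z| ≤ 1) ∧ IsFlow S T x y d := by
  classical
  obtain ⟨A, hA, hmax⟩ := Finset.exists_max_image
    (Finset.univ.filter fun A : Finset X => x ∈ A ∧ FlowsWithin S T x A) Finset.card
    ⟨{x}, by simpa using flowsWithin_singleton S T x⟩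
  simp only [Finset.mem_filter, Finset.mem_univ, true_and] at hA hmax
  have closed (a w : X) (haw : S a w ∨ T a w) (ha : a ∈ A) : w ∈ A := by
    by_contra hw
    have := hmax (insert w A) ⟨Finset.mem_insert_of_mem hA.1, hA.2.insert ha hw haw⟩
    rw [Finset.card_insert_of_notMem hw] at this
    omega
  have hle : S ⊔ T ≤ Setoid.ker (· ∈ A) := by
    refine sup_le ?_ ?_
    · exact fun a w haw => propext
        ⟨closed a w (Or.inl haw), closed w a (Or.inl (S.symm haw))⟩
    · exact fun a w haw => propext
        ⟨closed a w (Or.inr haw), closed w a (Or.inr (T.symm haw))⟩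
  have hy : y ∈ A := (iff_of_eq (hle h)).1 hA.1
  obtain ⟨d, hd, hflow⟩ := (hA.2 y hy).1
  exact ⟨d, hd.1, hflow⟩

end Flow

/-! ### The gap in the size of common independent sets -/

/-- A ground set with two copies of each point of `X`, elements that only the right side labels,
all with the label `x₀`, and elements that only the left side labels, all with the label `x₁`. -/
structure Layout (X U : Type*) (x₀ x₁ : X) where
  left : U → Option X
  right : U → Option X
  copy : X × Bool ↪ U
  source : U
  sink : U
  left_copy : ∀ z, left (copy z) = some z.1
  right_copy : ∀ z, right (copy z) = some z.1
  left_source : left source = none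
  right_source : right source = some x₀
  left_sink : left sink = some x₁
  right_sink : right sink = none
  label : ∀ u, (∃ x, left u = some x ∧ right u = some x) ∨
    (left u = none ∧ right u = some x₀) ∨ (left u = some x₁ ∧ right u = none)

namespace Layout

variable {x₀ x₁ : X} (Λ : Layout X U x₀ x₁)

theorem source_ne_sink : Λ.source ≠ Λ.sink := fun h => by
  simpa [Λ.left_source, Λ.left_sink] using congrArg Λ.left h

theorem copy_ne_source (z : X × Bool) : Λ.copy z ≠ Λ.source := fun h => by
  simpa [Λ.left_source, Λ.left_copy] using congrArg Λ.left h

theorem copy_ne_sink (z : X × Bool) : Λ.copy z ≠ Λ.sink := fun h => by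
  simpa [Λ.right_sink, Λ.right_copy] using congrArg Λ.right h

/-- Let `D` be the join class of `x₀`. Every element has its right label in `D` or its left label
outside `D`; these parts have at most `|D|` and `|Dᶜ|` elements. -/
theorem card_le_of_not_join [Fintype X] {P Q : Setoid X} (h : ¬ (P ⊔ Q) x₀ x₁) {I : Finset U}
    (hP : (blockMatroid P Λ.left).Indep (I : Set U))
    (hQ : (blockMatroid Q Λ.right).Indep (I : Set U)) : I.card ≤ Fintype.card X := by
  classical
  set D : Finset X := Finset.univ.filter fun x => (P ⊔ Q) x₀ x with hD
  have hPle : P ≤ P ⊔ Q := le_sup_left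
  have hQle : Q ≤ P ⊔ Q := le_sup_right
  have h1 := card_le_of_saturated hQ D fun x y hxy hx => by
    simp only [hD, Finset.mem_filter, Finset.mem_univ, true_and] at hx ⊢
    exact (P ⊔ Q).trans hx (hQle hxy)
  have h2 := card_le_of_saturated hP Dᶜ fun x y hxy hx => by
    simp only [hD, Finset.mem_compl, Finset.mem_filter, Finset.mem_univ, true_and] at hx ⊢
    exact fun hy => hx ((P ⊔ Q).trans hy ((P ⊔ Q).symm (hPle hxy)))
  rw [← Finset.card_add_card_compl D]
  refine le_trans (le_trans (Finset.card_le_card ?_) (Finset.card_union_le _ _)) (add_le_add h1 h2)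
  intro u hu
  rw [Finset.mem_union, Finset.mem_filter, Finset.mem_filter]
  rcases Λ.label u with ⟨x, hl, hr⟩ | ⟨-, hr⟩ | ⟨hl, -⟩
  · by_cases hx : x ∈ D
    · exact Or.inl ⟨hu, x, hx, hr⟩
    · exact Or.inr ⟨hu, x, Finset.mem_compl.2 hx, hl⟩
  · exact Or.inl ⟨hu, x₀, by simp [hD], hr⟩
  · exact Or.inr ⟨hu, x₁, by simp [hD, h], hl⟩

/-- One copy of each point. -/
def firstCopies [Fintype X] : Finset U :=
  Finset.univ.map ((Function.Embedding.sectL X false).trans Λ.copy)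

theorem card_firstCopies [Fintype X] : Λ.firstCopies.card = Fintype.card X := by
  simp [firstCopies]

theorem indep_firstCopies [Fintype X] (S : Setoid X) {f : U → Option X}
    (hf : ∀ z, f (Λ.copy z) = some z.1) :
    (blockMatroid S f).Indep (Λ.firstCopies : Set U) := by
  classical
  rw [blockMatroid_indep]
  simp [firstCopies, Finset.filter_map, hf]

open Classical in
theorem indep_insert_sink [Fintype X] (Q : Setoid X) :
    (blockMatroid Q Λ.right).Indep ((insert Λ.sink Λ.firstCopies : Finset U) : Set U) := by
  have h := Λ.indep_firstCopies Q Λ.right_copy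
  rw [blockMatroid_indep] at h ⊢
  refine ⟨?_, fun q => ?_⟩
  · rw [Finset.filter_insert, if_pos Λ.right_sink]
    refine (Finset.card_insert_le _ _).trans ?_
    simp [firstCopies, Finset.filter_map, Λ.right_copy]
  · rw [Finset.filter_insert, if_neg (by simp [Λ.right_sink])]
    exact h.2 q

/-- The rank does not depend on `Q`, which makes the union optimum a fixed shift of the intersection
optimum. -/
theorem exists_isBase_right [Fintype X] (Q : Setoid X) :
    ∃ B : Finset U, (blockMatroid Q Λ.right).IsBase (B : Set U) ∧
      B.card = Fintype.card X + 1 := by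
  classical
  refine ⟨insert Λ.sink Λ.firstCopies, ?_, ?_⟩
  · refine (Λ.indep_insert_sink Q).isBase_of_forall_insert ?_
    rintro e ⟨-, he⟩ hI
    rw [← Finset.coe_insert] at hI
    have := card_le_add_one hI
    rw [Finset.card_insert_of_notMem (by simpa using he), Finset.card_insert_of_notMem
      (by simp [firstCopies, Λ.copy_ne_sink]), card_firstCopies] at this
    omega
  · rw [Finset.card_insert_of_notMem, card_firstCopies]
    simp [firstCopies, Λ.copy_ne_sink]

/-- The copies used by a common independent set that a flow describes. -/
def flowCopies [Fintype X] (d : X → ℤ) : Finset (X × Bool) :=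
  Finset.univ.filter fun z => d z.1 ≤ if z.2 then -1 else 0

/-- The point `x` contributes `1 - d x` copies: two, one or none. -/
theorem card_flowCopies [Fintype X] {d : X → ℤ} (hd : ∀ x, |d x| ≤ 1) (K : X → Prop)
    [DecidablePred K] :
    (((flowCopies d).filter fun z => K z.1).card : ℤ) =
      (Finset.univ.filter K).card - ∑ x with K x, d x := by
  rw [flowCopies, Finset.filter_filter, Finset.card_filter, Finset.card_filter, Finset.sum_filter,
    ← Finset.univ_product_univ, Finset.sum_product]
  simp only [Fintype.sum_bool]
  push_cast
  rw [← Finset.sum_sub_distrib]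
  refine Finset.sum_congr rfl fun x _ => ?_
  have hx := abs_le.1 (hd x)
  by_cases hK : K x
  · obtain h | h | h : d x = -1 ∨ d x = 0 ∨ d x = 1 := by omega
    all_goals simp [hK, h]
  · simp [hK]

theorem card_filter_insert_insert [DecidableEq U] (J : Finset (X × Bool)) (p : U → Prop)
    [DecidablePred p] :
    ((insert Λ.source (insert Λ.sink (J.map Λ.copy))).filter p).card =
      (if p Λ.source then 1 else 0) + ((if p Λ.sink then 1 else 0) +
        (J.filter fun z => p (Λ.copy z)).card) := by
  rw [Finset.card_filter, Finset.sum_insert, Finset.sum_insert, Finset.sum_map, Finset.card_filter]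
  · simp [Λ.copy_ne_sink]
  · simp [Λ.copy_ne_source, Λ.source_ne_sink]

theorem exists_common_of_join [Fintype X] {P Q : Setoid X} (h : (P ⊔ Q) x₀ x₁) :
    ∃ I : Finset U, (blockMatroid P Λ.left).Indep (I : Set U) ∧
      (blockMatroid Q Λ.right).Indep (I : Set U) ∧ I.card = Fintype.card X + 1 := by
  classical
  obtain ⟨d, hd, hQ, hP⟩ := exists_isFlow (S := Q) (T := P) (x := x₀) (y := x₁) (by rwa [sup_comm])
  -- The flow frees one unit in the `Q`-class of `x₀` for the source and one in the `P`-class of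
  -- `x₁` for the sink.
  refine ⟨insert Λ.source (insert Λ.sink ((flowCopies d).map Λ.copy)), ?_, ?_, ?_⟩
  · rw [blockMatroid_indep]
    refine ⟨?_, fun q => ?_⟩
    · rw [card_filter_insert_insert]
      simp [Λ.left_source, Λ.left_sink, Λ.left_copy]
    · have h1 := hP q
      have h2 := card_flowCopies hd (fun x => Quotient.mk P x = q)
      simp only [classSum, AddMonoidHom.coe_mk, ZeroHom.coe_mk] at h1
      rw [card_filter_insert_insert]
      simp only [Λ.left_source, Λ.left_sink, Λ.left_copy, Option.map_none, Option.map_some,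
        Option.some.injEq, reduceCtorEq, if_false]
      rw [h1] at h2
      split_ifs at h2 ⊢ <;> omega
  · rw [blockMatroid_indep]
    refine ⟨?_, fun q => ?_⟩
    · rw [card_filter_insert_insert]
      simp [Λ.right_source, Λ.right_sink, Λ.right_copy]
    · have h1 := hQ q
      have h2 := card_flowCopies hd (fun x => Quotient.mk Q x = q)
      simp only [classSum, AddMonoidHom.coe_mk, ZeroHom.coe_mk] at h1
      rw [card_filter_insert_insert]
      simp only [Λ.right_source, Λ.right_sink, Λ.right_copy, Option.map_none, Option.map_some,
        Option.some.injEq, reduceCtorEq, if_false]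
      rw [h1] at h2
      split_ifs at h2 ⊢ <;> omega
  · have h1 := Λ.card_filter_insert_insert (flowCopies d) fun _ => True
    have h2 := card_flowCopies hd (fun _ => True)
    have h3 : ∑ x, d x = 1 := by
      rw [← Finset.sum_fiberwise (s := Finset.univ) (g := Quotient.mk Q)]
      have := hQ
      simp only [classSum, AddMonoidHom.coe_mk, ZeroHom.coe_mk] at this
      simp [this]
    simp only [Finset.filter_true, if_true, h3, Finset.card_univ] at h1 h2
    omega

open Classical in
/-- The maximum size of a common independent set of the matroids of `P` and `Q`. -/
noncomputable def optimum [Fintype X] (P Q : Setoid X) (x₀ x₁ : X) : ℕ :=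
  if (P ⊔ Q) x₀ x₁ then Fintype.card X + 1 else Fintype.card X

theorem exists_common [Fintype X] (P Q : Setoid X) :
    ∃ I : Finset U, (blockMatroid P Λ.left).Indep (I : Set U) ∧
      (blockMatroid Q Λ.right).Indep (I : Set U) ∧ I.card = optimum P Q x₀ x₁ := by
  by_cases h : (P ⊔ Q) x₀ x₁
  · simpa [optimum, h] using Λ.exists_common_of_join h
  · exact ⟨Λ.firstCopies, Λ.indep_firstCopies P Λ.left_copy, Λ.indep_firstCopies Q Λ.right_copy,
      by simp [optimum, h, card_firstCopies]⟩

theorem card_le_optimum [Fintype X] {P Q : Setoid X} {I : Finset U}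
    (hP : (blockMatroid P Λ.left).Indep (I : Set U))
    (hQ : (blockMatroid Q Λ.right).Indep (I : Set U)) : I.card ≤ optimum P Q x₀ x₁ := by
  by_cases h : (P ⊔ Q) x₀ x₁
  · simpa [optimum, h] using card_le_add_one hP
  · simpa [optimum, h] using Λ.card_le_of_not_join h hP hQ

end Layout

end BlockMatroid

/-! ### From intersection to union by duality -/

/-- Independent sets of `N✶` are those avoiding some base `C` of `N`. The best union is thus `Cᶜ`
together with a common independent set inside `C`; loopy matroids add nothing. -/
theorem card_eq_of_isMaxUnionOfIndep {U : Type*} [Fintype U] {k : ℕ} {M : Fin k → Matroid U}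
    {i₀ i₁ : Fin k} (hne : i₀ ≠ i₁) {N : Matroid U} (hN : N.E = Set.univ)
    (h₁ : M i₁ = N✶) (hM : ∀ i, i ≠ i₀ → i ≠ i₁ → M i = Matroid.loopyOn Set.univ)
    {B : Finset U} (hB : N.IsBase (B : Set U)) {m : ℕ}
    (hex : ∃ I : Finset U, (M i₀).Indep (I : Set U) ∧ N.Indep (I : Set U) ∧ I.card = m)
    (hle : ∀ I : Finset U, (M i₀).Indep (I : Set U) → N.Indep (I : Set U) → I.card ≤ m)
    {S : Finset U} (hS : IsMaxUnionOfIndep M S) : S.card + B.card = m + Fintype.card U := by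
  classical
  have hbase (C : Set U) (hC : N.IsBase C) : C.ncard = B.card := by
    rw [hC.ncard_eq_ncard_of_isBase hB, Set.ncard_coe_finset]
  refine le_antisymm ?_ ?_
  · obtain ⟨⟨I, hI, hSI⟩, -⟩ := hS
    have h1 := hI i₁
    rw [h₁, Matroid.dual_indep_iff_exists'] at h1
    obtain ⟨-, C, hC, hdisj⟩ := h1
    have hsub : S ⊆ (I i₀ ∩ C.toFinset) ∪ C.toFinsetᶜ := by
      intro u hu
      have hu' : u ∈ (S : Set U) := hu
      rw [hSI, Set.mem_iUnion] at hu'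
      obtain ⟨j, hj⟩ := hu'
      by_cases hj0 : j = i₀
      · subst hj0
        by_cases huC : u ∈ C <;> simp_all
      · by_cases hj1 : j = i₁
        · subst hj1
          have := Set.disjoint_left.1 hdisj hj
          simp [this]
        · have hj' := hI j
          rw [hM j hj0 hj1, Matroid.loopyOn_indep_iff] at hj'
          rw [hj'] at hj
          exact absurd hj (Set.notMem_empty u)
    have h2 := hle (I i₀ ∩ C.toFinset) ((hI i₀).subset (by simp)) (hC.indep.subset (by simp))
    have h3 := (Finset.card_le_card hsub).trans (Finset.card_union_le _ _)
    have h4 := Finset.card_add_card_compl C.toFinset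
    have h5 := hbase C hC
    rw [Set.ncard_eq_toFinset_card'] at h5
    omega
  · obtain ⟨I, hI0, hIN, hcard⟩ := hex
    obtain ⟨C, hC, hIC⟩ := hIN.exists_isBase_superset
    have hunion : IsUnionOfIndep M (I ∪ C.toFinsetᶜ) := by
      refine ⟨fun j => if j = i₀ then I else if j = i₁ then C.toFinsetᶜ else ∅, fun j => ?_, ?_⟩
      · by_cases hj0 : j = i₀
        · simpa [hj0] using hI0
        · by_cases hj1 : j = i₁
          · subst hj1
            simp only [hj0, if_true, if_false]
            rw [h₁, Matroid.dual_indep_iff_exists', hN]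
            exact ⟨Set.subset_univ _, C, hC, by simpa using disjoint_compl_left⟩
          · simp [hj0, hj1]
      · ext u
        simp only [Finset.coe_union, Set.mem_union, Set.mem_iUnion, Finset.mem_coe]
        constructor
        · rintro (hu | hu)
          · exact ⟨i₀, by simpa using hu⟩
          · exact ⟨i₁, by simpa [hne.symm] using hu⟩
        · rintro ⟨j, hj⟩
          split_ifs at hj with h1 h2
          · exact Or.inl hj
          · exact Or.inr hj
          · simp at hj
    have h2 := hS.2 _ hunion
    rw [Finset.card_union_of_disjoint] at h2
    · have h4 := Finset.card_add_card_compl C.toFinset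
      have h5 := hbase C hC
      rw [Set.ncard_eq_toFinset_card'] at h5
      omega
    · rw [Finset.disjoint_left]
      intro u hu
      simpa using hIC hu

/-! ### Hard instances and the final bound -/

/-- The points on which the equivalence relations of the hard instances live. -/
abbrev HardPoint (k : ℕ) : Type := (Fin k ⊕ Fin k) ⊕ Bool

/-- Two copies of `2k + 2` points, a source and a sink need `4k + 6` elements. Surplus elements get
the labels of the source, which the upper bounds allow. -/
theorem exists_layout {U : Type*} [Fintype U] (k : ℕ) (h : 4 * k + 6 ≤ Fintype.card U) :
    Nonempty (Layout (HardPoint k) U (Sum.inr false) (Sum.inr true)) := by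
  obtain ⟨r, hr⟩ := Nat.exists_eq_add_of_le h
  have e : U ≃ (HardPoint k × Bool) ⊕ Option (Fin (r + 1)) := by
    refine Fintype.equivOfCardEq ?_
    simp only [hr, Fintype.card_sum, Fintype.card_prod, Fintype.card_bool, Fintype.card_option,
      Fintype.card_fin]
    omega
  exact ⟨{
    left := fun u => Sum.elim (fun z => some z.1) (fun o => o.elim (some (Sum.inr true))
      fun _ => none) (e u)
    right := fun u => Sum.elim (fun z => some z.1) (fun o => o.elim none
      fun _ => some (Sum.inr false)) (e u)
    copy := Function.Embedding.inl.trans e.symm.toEmbedding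
    source := e.symm (Sum.inr (some 0))
    sink := e.symm (Sum.inr none)
    left_copy := by simp
    right_copy := by simp
    left_source := by simp
    right_source := by simp
    left_sink := by simp
    right_sink := by simp
    label := fun u => by rcases e u with z | (_ | i) <;> simp }⟩

/-- If the size of the output differs from the optimum by a constant, then some instance is
expensive. -/
theorem exists_pow_le_two_pow_cost {U : Type*} [Fintype U] [DecidableEq U] {k κ : ℕ}
    (A : DynRankAlg κ U)
    {M : Setoid.Separating (X := HardPoint k) (Sum.inr false) (Sum.inr true) →
      Setoid.Separating (X := HardPoint k) (Sum.inr false) (Sum.inr true) → Fin κ → Matroid U}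
    (hM : DynRankAlg.IsSplit M) (s t : ℕ)
    (hs : ∀ P Q, (A.result (M P Q)).card + s =
      Layout.optimum P.1 Q.1 (Sum.inr false) (Sum.inr true) + t) :
    ∃ P Q, k ^ k ≤ 2 ^ A.cost (M P Q) := by
  classical
  obtain ⟨⟨P, Q⟩, -, hmax⟩ := Finset.exists_max_image
    (Finset.univ : Finset (Setoid.Separating (X := HardPoint k) (Sum.inr false) (Sum.inr true) ×
      Setoid.Separating (X := HardPoint k) (Sum.inr false) (Sum.inr true)))
    (fun z => A.cost (M z.1 z.2)) ⟨(gluing id, gluing id), Finset.mem_univ _⟩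
  refine ⟨P, Q, (pow_le_card_separating k).trans ?_⟩
  rw [← Setoid.rank_joinMatrix]
  refine A.rank_le_two_pow_cost hM _
    -- The entry is `1` exactly when the optimum is `|X|`, which the output size reveals after the
    -- shift.
    (fun S => if S.card + s = Fintype.card (HardPoint k) + t then 1 else 0) _
    (fun P' Q' => hmax (P', Q') (Finset.mem_univ _)) fun P' Q' => ?_
  rw [hs P' Q', Setoid.joinMatrix, Matrix.of_apply, Layout.optimum]
  split_ifs with h1 h2 <;> first | rfl | omega

/-- For large `n`, `n ≤ 8k` and `n ≤ k ^ 2`, so `n log n ≤ 16 k log k`; this is the source of `1 /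
16`. -/
theorem log_bound {n T : ℕ} (hn : 4096 ≤ n) (h : ((n - 6) / 4) ^ ((n - 6) / 4) ≤ 2 ^ T) :
    1 / 16 * ((n : ℝ) * Real.log n) ≤ T := by
  set k := (n - 6) / 4 with hk
  have hk8 : n ≤ 8 * k := by omega
  have hk0 : (0 : ℝ) < k := by
    have : 0 < k := by omega
    exact_mod_cast this
  have h8 : (n : ℝ) ≤ 8 * k := by exact_mod_cast hk8
  have hn0 : (0 : ℝ) < n := by
    have : 0 < n := by omega
    exact_mod_cast this
  have h64 : n ≤ k ^ 2 := by nlinarith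
  have hlogn : Real.log n ≤ 2 * Real.log k := by
    have h64' : (n : ℝ) ≤ (k : ℝ) ^ 2 := by exact_mod_cast h64
    have := Real.log_le_log hn0 h64'
    rwa [Real.log_pow] at this
  have hlogk : 0 ≤ Real.log k := Real.log_natCast_nonneg k
  have h' : ((k : ℝ)) ^ k ≤ 2 ^ T := by exact_mod_cast h
  have hlog := Real.log_le_log (by positivity) h'
  rw [Real.log_pow, Real.log_pow] at hlog
  have hlog2 : Real.log 2 ≤ 1 := by
    have := Real.log_two_lt_d9
    linarith
  calc 1 / 16 * ((n : ℝ) * Real.log n) ≤ 1 / 16 * ((8 * k) * (2 * Real.log k)) := by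
        gcongr
    _ = k * Real.log k := by ring
    _ ≤ T * Real.log 2 := hlog
    _ ≤ T := mul_le_of_le_one_right (by positivity) hlog2

theorem exists_expensive_intersection {U : Type*} [Fintype U] [DecidableEq U]
    (hn : 4096 ≤ Fintype.card U) (A : DynRankAlg 2 U) (hA : A.SolvesIntersection) :
    ∃ M : Fin 2 → Matroid U, (∀ j, (M j).E = Set.univ) ∧
      1 / 16 * ((Fintype.card U : ℝ) * Real.log (Fintype.card U : ℝ)) ≤ (A.cost M : ℝ) := by
  obtain ⟨Λ⟩ := exists_layout (U := U) ((Fintype.card U - 6) / 4) (by omega)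
  have hE (P Q : Setoid (HardPoint ((Fintype.card U - 6) / 4))) (j : Fin 2) :
      ((![blockMatroid P Λ.left, blockMatroid Q Λ.right] : Fin 2 → Matroid U) j).E = Set.univ := by
    fin_cases j <;> simp
  obtain ⟨P, Q, h⟩ := exists_pow_le_two_pow_cost A
    (M := fun P Q => ![blockMatroid P.1 Λ.left, blockMatroid Q.1 Λ.right])
    (fun j => by
      fin_cases j
      · exact Or.inl ⟨fun P => blockMatroid P.1 Λ.left, fun _ _ => rfl⟩
      · exact Or.inr ⟨fun Q => blockMatroid Q.1 Λ.right, fun _ _ => rfl⟩) 0 0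
    (fun P Q => by
      obtain ⟨hind, hmax⟩ := hA _ (hE P.1 Q.1)
      obtain ⟨I, hP, hQ, hI⟩ := Λ.exists_common P.1 Q.1
      have h1 := hmax I (Fin.forall_fin_two.2 ⟨hP, hQ⟩)
      have h2 := Λ.card_le_optimum (hind 0) (hind 1)
      omega)
  exact ⟨_, hE P.1 Q.1, log_bound hn h⟩

/-- The matroid union instance of two equivalence relations. -/
noncomputable def unionInstance {X U : Type*} [Fintype X] {x₀ x₁ : X} (Λ : Layout X U x₀ x₁)
    {k : ℕ} (i₀ i₁ : Fin k) (P Q : Setoid X) (i : Fin k) : Matroid U :=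
  if i = i₀ then blockMatroid P Λ.left else
    if i = i₁ then (blockMatroid Q Λ.right)✶ else Matroid.loopyOn Set.univ

theorem exists_expensive_union {U : Type*} [Fintype U] [DecidableEq U]
    (hn : 4096 ≤ Fintype.card U) {k : ℕ} (hk : 2 ≤ k) (A : DynRankAlg k U)
    (hA : A.SolvesUnion) :
    ∃ M : Fin k → Matroid U, (∀ j, (M j).E = Set.univ) ∧
      1 / 16 * ((Fintype.card U : ℝ) * Real.log (Fintype.card U : ℝ)) ≤ (A.cost M : ℝ) := by
  obtain ⟨Λ⟩ := exists_layout (U := U) ((Fintype.card U - 6) / 4) (by omega)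
  let i₀ : Fin k := ⟨0, by omega⟩
  let i₁ : Fin k := ⟨1, by omega⟩
  have hne : i₀ ≠ i₁ := by simp [i₀, i₁]
  have hE (P Q : Setoid (HardPoint ((Fintype.card U - 6) / 4))) (j : Fin k) :
      (unionInstance Λ i₀ i₁ P Q j).E = Set.univ := by
    unfold unionInstance
    split_ifs <;> simp
  obtain ⟨P, Q, h⟩ := exists_pow_le_two_pow_cost A
    (M := fun P Q => unionInstance Λ i₀ i₁ P.1 Q.1)
    (fun j => by
      by_cases h0 : j = i₀
      · exact Or.inl ⟨fun P => blockMatroid P.1 Λ.left, fun _ _ => by simp [unionInstance, h0]⟩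
      -- The first relation is a dummy here: only the matroid `i₀` reads it.
      · exact Or.inr ⟨fun Q => unionInstance Λ i₀ i₁ Q.1 Q.1 j,
          fun _ _ => by simp [unionInstance, h0]⟩)
    -- The shifts are the rank of the right matroid and the size of `U`.
    (Fintype.card (HardPoint ((Fintype.card U - 6) / 4)) + 1) (Fintype.card U)
    (fun P Q => by
      obtain ⟨B, hB, hcard⟩ := Λ.exists_isBase_right Q.1
      have hM0 : unionInstance Λ i₀ i₁ P.1 Q.1 i₀ = blockMatroid P.1 Λ.left := by
        simp [unionInstance]
      rw [← hcard]
      refine card_eq_of_isMaxUnionOfIndep hne (blockMatroid_ground Q.1 Λ.right)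
        (by simp [unionInstance, hne.symm]) (fun i h0 h1 => by simp [unionInstance, h0, h1]) hB
        ?_ ?_ (hA _ (hE P.1 Q.1))
      · rw [hM0]
        exact Λ.exists_common P.1 Q.1
      · rw [hM0]
        exact fun I hP hQ => Λ.card_le_optimum hP hQ)
  exact ⟨_, hE P.1 Q.1, log_bound hn h⟩

theorem mainTheorem6 :
    (∃ c : ℝ, 0 < c ∧ ∃ N : ℕ, ∀ (U : Type*) [Fintype U] [DecidableEq U], N ≤ Fintype.card U →
      ∀ A : DynRankAlg 2 U, A.SolvesIntersection →
        ∃ M : Fin 2 → Matroid U, (∀ j, (M j).E = Set.univ) ∧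
          c * ((Fintype.card U : ℝ) * Real.log (Fintype.card U : ℝ)) ≤ (A.cost M : ℝ)) ∧
    (∃ c : ℝ, 0 < c ∧ ∃ N : ℕ, ∀ (U : Type*) [Fintype U] [DecidableEq U], N ≤ Fintype.card U →
      ∀ k : ℕ, 2 ≤ k → ∀ A : DynRankAlg k U, A.SolvesUnion →
        ∃ M : Fin k → Matroid U, (∀ j, (M j).E = Set.univ) ∧
          c * ((Fintype.card U : ℝ) * Real.log (Fintype.card U : ℝ)) ≤ (A.cost M : ℝ)) := by
  refine ⟨⟨1 / 16, by norm_num, 4096, ?_⟩, ⟨1 / 16, by norm_num, 4096, ?_⟩⟩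
  · intro U _ _ hn A hA
    exact exists_expensive_intersection hn A hA
  · intro U _ _ hn k hk A hA
    exact exists_expensive_union hn hk A hA
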